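/- All matrices are complex $d\times d$ matrices. For Hermitian $M$ let $\lambda_1^\downarrow(M)\ge\dots\ge\lambda_d^\downarrow(M)$ be its eigenvalues, with multiplicity, in non-increasing order. For Hermitian $G$ and $C$ let $\delta(C;G)\in\mathbb R^d$ be the vector whose entries are determined by $$\sum_{j=1}^k\delta_j(C;G)=\left.\frac{d}{dt}\right|_{t=0^+}\sum_{j=1}^k\lambda_j^\downarrow(G+tC),\qquad 1\le k\le d,$$ where the derivative is the derivative from the right at $t=0$. For $a,b\in\mathbb R^d$ write $a\prec_{dw}b$ if $\sum_{j=1}^k a_j\le\sum_{j=1}^k b_j$ for every $k=1,\dots,d$ (no rearrangement of the entries). Let $A,B\ge 0$ be positive semidefinite. (i) For every non-negative concave function $f$ on $[0,\infty)$, the vectors $\delta(f(A+B);A+B)$ and $\delta(f(A)+f(B);A+B)$ are well defined (all the one-sided derivatives exist) and $$\delta(f(A+B);A+B)\prec_{dw}\delta(f(A)+f(B);A+B).$$ (ii) For every non-negative convex function $g$ on $[0,\infty)$ with $g(0)=0$, the vectors $\delta(g(A+B);A+B)$ and $\delta(g(A)+g(B);A+B)$ are well defined and $$\delta(g(A)+g(B);A+B)\prec_{dw}\delta(g(A+B);A+B).$$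 -/

import Mathlib

open scoped ComplexOrder

/-- The vector `λ↓(M)` of eigenvalues of a Hermitian matrix `M`, with multiplicity, sorted in
non-increasing order (`0` by convention if `M` is not Hermitian). -/
noncomputable def eigDown {n : Type*} [Fintype n] [DecidableEq n] (M : Matrix n n ℂ) :
    Fin (Fintype.card n) → ℝ :=
  open Classical in if h : M.IsHermitian then h.eigenvalues₀ else 0

theorem eigDown_of_isHermitian {n : Type*} [Fintype n] [DecidableEq n] {M : Matrix n n ℂ}
    (h : M.IsHermitian) : eigDown M = h.eigenvalues₀ := by
  simp [eigDown, h]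

theorem eigDown_antitone {n : Type*} [Fintype n] [DecidableEq n] (M : Matrix n n ℂ) :
    Antitone (eigDown M) := by
  by_cases h : M.IsHermitian
  · rw [eigDown_of_isHermitian h]
    exact h.eigenvalues₀_antitone
  · intro i j _
    simp [eigDown, h]

/-- The sum `a_1 + ⋯ + a_k` of the first `k` entries of a vector `a`, without rearrangement. -/
def headSum {d : ℕ} (k : ℕ) (a : Fin d → ℝ) : ℝ :=
  ∑ j : Fin d with j.val < k, a j

/-- Weak majorisation with missing rearrangement, `a ≺_dw b`. -/
def WeakMajDW {d : ℕ} (a b : Fin d → ℝ) : Prop :=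
  ∀ k : ℕ, k ≤ d → headSum k a ≤ headSum k b

/-- The derivative from the right at `t = 0` of the sum of the `k` largest eigenvalues
of `G + t C`. -/
noncomputable def headDeriv {n : Type*} [Fintype n] [DecidableEq n] (C G : Matrix n n ℂ)
    (k : ℕ) : ℝ :=
  derivWithin (fun t : ℝ => headSum k (eigDown (G + t • C))) (Set.Ici 0) 0

/-- The vector `δ(C; G)`: the vector whose first `k` entries sum to the derivative from the right
at `t = 0` of the sum of the `k` largest eigenvalues of `G + t C`, for every `k`
(see `headSum_delta`). -/
noncomputable def delta {n : Type*} [Fintype n] [DecidableEq n] (C G : Matrix n n ℂ) :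
    Fin (Fintype.card n) → ℝ :=
  fun j => headDeriv C G (j.val + 1) - headDeriv C G j.val

theorem headSum_delta {n : Type*} [Fintype n] [DecidableEq n] (C G : Matrix n n ℂ) (k : ℕ)
    (hk : k ≤ Fintype.card n) : headSum k (delta C G) = headDeriv C G k := by
  have h0 : headDeriv C G 0 = 0 := by simp [headDeriv, headSum]
  have key : headSum k (delta C G)
      = ∑ i ∈ Finset.range k, (headDeriv C G (i + 1) - headDeriv C G i) := by
    unfold headSum
    refine Finset.sum_bij (fun j _ => j.val) ?_ ?_ ?_ ?_
    · intro j hj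
      simpa using hj
    · intro i _ j _ h
      exact Fin.ext h
    · intro i hi
      rw [Finset.mem_range] at hi
      exact ⟨⟨i, lt_of_lt_of_le hi hk⟩, by simpa using hi, rfl⟩
    · intro j _
      rfl
  rw [key, Finset.sum_range_sub, h0, sub_zero]

/-- `δ(C; G)` is well defined: the one-sided derivatives in its definition really exist
and are the partial sums of `δ(C; G)`. -/
def DeltaExists {n : Type*} [Fintype n] [DecidableEq n] (C G : Matrix n n ℂ) : Prop :=
  ∀ k : ℕ, k ≤ Fintype.card n →
    HasDerivWithinAt (fun t : ℝ => headSum k (eigDown (G + t • C)))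
      (headSum k (delta C G)) (Set.Ici 0) 0

/-! Write G = A + B. Both perturbed head sums agree at t = 0, so it suffices to compare them for
every t ≥ 0. By Ky Fan's principle the sum of the k largest eigenvalues of M is the maximum of
tr(RM) over 0 ≤ R ≤ 1 with tr R = k. The convex case thus reduces to tr(R(g(A) + g(B))) ≤ ∑_{j≤k}
g(λ_j(G)) for all such R (`trace_re_mul_cfc_add_cfc_le`): the leading spectral projection of G
attains the right side and maximises tr(RG) too.

On the finitely many eigenvalues involved, g is a non-negative combination of hinges (x - c)₊ with c
≥ 0, so only hinges matter. For c ≥ λ_k(G) the bound follows from the full trace inequality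
`sum_max_sub_add_sum_max_sub_le`; for smaller c it is interpolated between c = λ_k(G) and the linear
case c = 0 (`sum_mul_max_sub_le_headSum`).

The concave case applies this to g(x) = cx - f(x) + f(0) with c large; the linear terms cancel when
R maximises tr(RG). -/

/-! ### Convex and concave functions on the half-line. -/

/-- F is the piecewise linear interpolant of g at 0 and the points of S; convexity makes the slope
jumps non-negative. The predicate `C` stands for any inequality stable under adding non-negative
multiples of hinges. -/
theorem exists_sum_max_eqOn_finset (C : (ℝ → ℝ) → Prop) (h0 : C 0)
    (hadd : ∀ F c s, C F → 0 ≤ c → 0 ≤ s → C (fun x => F x + s * max (x - c) 0))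
    {g : ℝ → ℝ} (hg : ConvexOn ℝ (Set.Ici 0) g) (hg0 : g 0 = 0) (S : Finset ℝ)
    (hS : ∀ x ∈ S, 0 ≤ x ∧ 0 ≤ g x) : ∃ F, C F ∧ ∀ x ∈ S, F x = g x := by
  -- Induction invariant: y is the last node, past which F is affine and below g. The proviso `0 ≤ g
  -- x` is needed at the start, where F = 0 and g is known to be non-negative only on S.
  suffices H : ∃ F, C F ∧ (∀ x ∈ S, F x = g x) ∧ ∃ y ∈ insert 0 S, (∀ x ∈ S, x ≤ y) ∧
      F y = g y ∧ (∃ a, ∀ x, y ≤ x → F x = g y + a * (x - y)) ∧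
      ∀ x, y < x → 0 ≤ g x → F x ≤ g x by
    obtain ⟨F, hF, h, -⟩ := H
    exact ⟨F, hF, h⟩
  induction S using Finset.induction_on_max with
  | empty =>
    refine ⟨0, h0, by simp, 0, by simp, by simp, by simp [hg0], ⟨0, by simp [hg0]⟩, ?_⟩
    intro x _ hx
    simpa using hx
  | insert z S hz ih =>
    obtain ⟨F, hF, hFS, y, hyS, hy, hFy, ⟨a, ha⟩, hle⟩ :=
      ih fun x hx => hS x (Finset.mem_insert_of_mem hx)
    have hz0 := hS z (Finset.mem_insert_self _ _)
    have hy0 : 0 ≤ y := by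
      rcases Finset.mem_insert.1 hyS with h | h
      · exact h.ge
      · exact (hS y (Finset.mem_insert_of_mem h)).1
    have hyz : y ≤ z := by
      rcases Finset.mem_insert.1 hyS with h | h
      · exact h ▸ hz0.1
      · exact (hz y h).le
    rcases hyz.eq_or_lt with rfl | hyz
    · refine ⟨F, hF, ?_, y, by simp, ?_, hFy, ⟨a, ha⟩, hle⟩
      · intro x hx
        rcases Finset.mem_insert.1 hx with rfl | hx
        · exact hFy
        · exact hFS x hx
      · intro x hx
        rcases Finset.mem_insert.1 hx with rfl | hx
        · exact le_rfl
        · exact hy x hx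
    · have hzy : 0 < z - y := sub_pos.2 hyz
      set b := (g z - g y) / (z - y) with hb
      have hbz : b * (z - y) = g z - g y := div_mul_cancel₀ _ hzy.ne'
      have hab : a ≤ b := by
        rw [hb, le_div_iff₀ hzy]
        have := hle z hyz hz0.2
        rw [ha z hyz.le] at this
        linarith
      have hval : ∀ x, y ≤ x → F x + (b - a) * max (x - y) 0 = g y + b * (x - y) := by
        intro x hx
        rw [ha x hx, max_eq_left (sub_nonneg.2 hx)]
        ring
      have hzval : g y + b * (z - y) = g z := by rw [hbz]; ring
      refine ⟨_, hadd F y (b - a) hF hy0 (sub_nonneg.2 hab), ?_, z, by simp, ?_, ?_, ⟨b, ?_⟩, ?_⟩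
      · intro x hx
        rcases Finset.mem_insert.1 hx with rfl | hx
        · rw [hval x hyz.le, hzval]
        · rw [max_eq_right (sub_nonpos.2 (hy x hx)), mul_zero, add_zero, hFS x hx]
      · intro x hx
        rcases Finset.mem_insert.1 hx with rfl | hx
        · exact le_rfl
        · exact (hz x hx).le
      · rw [hval z hyz.le, hzval]
      · intro x hx
        rw [hval x (hyz.le.trans hx), ← hzval]
        ring
      · intro x hx _
        rw [hval x (hyz.trans hx).le]
        have := hg.secant_mono_aux2 (Set.mem_Ici.2 hy0)
          (Set.mem_Ici.2 ((hy0.trans hyz.le).trans hx.le)) hyz hx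
        have hxy : 0 < x - y := sub_pos.2 (hyz.trans hx)
        have h2 : b * (x - y) ≤ g x - g y := (le_div_iff₀ hxy).1 this
        linarith

theorem monotoneOn_of_concaveOn_of_nonneg {f : ℝ → ℝ} (hf : ConcaveOn ℝ (Set.Ici 0) f)
    (hf0 : ∀ x, 0 ≤ x → 0 ≤ f x) : MonotoneOn f (Set.Ici 0) := by
  intro x hx y hy hxy
  rcases hxy.eq_or_lt with rfl | hxy
  · exact le_rfl
  by_contra! h
  have hyx : 0 < y - x := sub_pos.2 hxy
  have hs : 0 < f x - f y := sub_pos.2 h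
  -- The line through the graph points at x and y takes the value -1 at z.
  set z := y + (f y + 1) * (y - x) / (f x - f y) with hz
  have hfy := hf0 y hy
  have hyz : y < z := by
    have : 0 < (f y + 1) * (y - x) / (f x - f y) := by positivity
    linarith
  have hz0 : 0 ≤ z := (Set.mem_Ici.1 hy).trans hyz.le
  have h1 := hf.slope_anti_adjacent hx (Set.mem_Ici.2 hz0) hxy hyz
  have h2 := (div_le_iff₀ (sub_pos.2 hyz)).1 h1
  have h3 : (f y - f x) / (y - x) * (z - y) = -(f y + 1) := by
    rw [hz]
    field_simp
    ring
  have := hf0 z hz0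
  linarith

/-! ### Head sums -/

theorem card_filter_val_lt {d k : ℕ} (hk : k ≤ d) :
    (Finset.univ.filter fun j : Fin d => j.val < k).card = k := by
  simpa [hk] using Fin.card_filter_val_lt (n := d) (m := k)

theorem headSum_eq_sum_ite {d : ℕ} (k : ℕ) (a : Fin d → ℝ) :
    headSum k a = ∑ j, (if j.val < k then (1 : ℝ) else 0) * a j := by
  simp [headSum, Finset.sum_filter]

theorem headSum_const {d k : ℕ} (hk : k ≤ d) (c : ℝ) : headSum k (fun _ : Fin d => c) = k * c := by
  simp [headSum, card_filter_val_lt hk]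

theorem sum_mul_le_headSum {d k : ℕ} (hk : k ≤ d) {a w : Fin d → ℝ} (ha : Antitone a)
    (hw0 : ∀ j, 0 ≤ w j) (hw1 : ∀ j, w j ≤ 1) (hw : ∑ j, w j = k) :
    ∑ j, w j * a j ≤ headSum k a := by
  rcases Nat.eq_zero_or_pos k with rfl | hk0
  · have : ∀ j, w j = 0 := by
      simpa [Finset.sum_eq_zero_iff_of_nonneg (fun j _ => hw0 j)] using hw
    simp [this, headSum]
  -- Subtracting the k-th largest entry makes the first k entries non-negative and the others
  -- non-positive; the total weight k cancels the shift.
  · set s := a ⟨k - 1, by omega⟩ with hs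
    have h1 : ∑ j, w j * (a j - s) ≤ headSum k (fun j => a j - s) := by
      rw [headSum_eq_sum_ite]
      refine Finset.sum_le_sum fun j _ => ?_
      split_ifs with hj
      · have : s ≤ a j := ha (Fin.mk_le_mk.2 (by omega) : j ≤ ⟨k - 1, by omega⟩)
        exact mul_le_mul_of_nonneg_right (hw1 j) (sub_nonneg.2 this)
      · have : a j ≤ s := ha (Fin.mk_le_mk.2 (by omega) : (⟨k - 1, by omega⟩ : Fin d) ≤ j)
        rw [zero_mul]
        exact mul_nonpos_of_nonneg_of_nonpos (hw0 j) (sub_nonpos.2 this)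
    have h2 : headSum k (fun j => a j - s) = headSum k a - k * s := by
      rw [← headSum_const hk]
      simp [headSum]
    have h3 : ∑ j, w j * (a j - s) = ∑ j, w j * a j - k * s := by
      simp_rw [mul_sub]
      rw [Finset.sum_sub_distrib, ← Finset.sum_mul, hw]
    linarith

theorem headSum_add {d : ℕ} (k : ℕ) (a b : Fin d → ℝ) :
    headSum k (fun j => a j + b j) = headSum k a + headSum k b :=
  Finset.sum_add_distrib

theorem headSum_const_mul {d : ℕ} (k : ℕ) (c : ℝ) (a : Fin d → ℝ) :
    headSum k (fun j => c * a j) = c * headSum k a :=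
  (Finset.mul_sum ..).symm

/-! ### Spectral weights -/

section Spectral

variable {n : Type*} [Fintype n] [DecidableEq n]

theorem exists_cfc_eq_mul_diagonal_mul {M : Matrix n n ℂ} (hM : M.IsHermitian) :
    ∃ (U : Matrix n n ℂ) (e : Fin (Fintype.card n) ≃ n), U.conjTranspose * U = 1 ∧
      U * U.conjTranspose = 1 ∧ ∀ h : ℝ → ℝ, cfc h M =
        U * Matrix.diagonal (fun i => (h (eigDown M (e.symm i)) : ℂ)) * U.conjTranspose := by
  refine ⟨(hM.eigenvectorUnitary : Matrix n n ℂ), Fintype.equivOfCardEq (Fintype.card_fin _),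
    Unitary.coe_star_mul_self _, Unitary.coe_mul_star_self _, fun h => ?_⟩
  rw [hM.cfc_eq, eigDown_of_isHermitian hM]
  rfl

theorem Matrix.IsHermitian.cfc_id_eq {M : Matrix n n ℂ} (hM : M.IsHermitian) :
    cfc (fun x : ℝ => x) M = M :=
  cfc_id' ℝ M hM.isSelfAdjoint

/-- The weights are the diagonal entries of R in an eigenbasis of M, so one w serves every h. -/
theorem exists_spectral_weights {M R : Matrix n n ℂ} (hM : M.IsHermitian) (hR : R.PosSemidef) :
    ∃ w : Fin (Fintype.card n) → ℝ, (∀ j, 0 ≤ w j) ∧ ((1 - R).PosSemidef → ∀ j, w j ≤ 1) ∧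
      ∑ j, w j = R.trace.re ∧
      ∀ h : ℝ → ℝ, (R * cfc h M).trace.re = ∑ j, w j * h (eigDown M j) := by
  obtain ⟨U, e, hUU, hUU', hcfc⟩ := exists_cfc_eq_mul_diagonal_mul hM
  have hw0 := hR.conjTranspose_mul_mul_same U
  refine ⟨fun j => ((U.conjTranspose * R * U) (e j) (e j)).re, ?_, ?_, ?_, ?_⟩
  · intro j
    exact (Complex.le_def.1 (hw0.diag_nonneg (i := e j))).1
  · intro h1 j
    have h2 := (h1.conjTranspose_mul_mul_same U).diag_nonneg (i := e j)
    have h3 : U.conjTranspose * (1 - R) * U = 1 - U.conjTranspose * R * U := by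
      rw [mul_sub, sub_mul, mul_one, hUU]
    rw [h3] at h2
    have h4 := (Complex.le_def.1 h2).1
    simpa using h4
  · rw [e.sum_comp (fun i => ((U.conjTranspose * R * U) i i).re), ← Complex.re_sum]
    change (Matrix.trace (U.conjTranspose * R * U)).re = _
    rw [Matrix.trace_mul_comm, ← mul_assoc, hUU', one_mul]
  · intro h
    rw [hcfc, ← mul_assoc, Matrix.trace_mul_comm, ← mul_assoc, ← mul_assoc, Matrix.trace,
      Complex.re_sum, ← e.sum_comp]
    refine Finset.sum_congr rfl fun j _ => ?_
    rw [Matrix.diag_apply, Matrix.mul_diagonal, Complex.re_mul_ofReal, e.symm_apply_apply]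

/-- Conversely, R can be taken diagonal in an eigenbasis of M; indicator weights give spectral
projections. -/
theorem exists_posSemidef_of_spectral_weights {M : Matrix n n ℂ} (hM : M.IsHermitian)
    {r : Fin (Fintype.card n) → ℝ} (hr0 : ∀ j, 0 ≤ r j) (hr1 : ∀ j, r j ≤ 1) :
    ∃ R : Matrix n n ℂ, R.PosSemidef ∧ (1 - R).PosSemidef ∧ R.trace.re = ∑ j, r j ∧
      ∀ h : ℝ → ℝ, (R * cfc h M).trace.re = ∑ j, r j * h (eigDown M j) := by
  obtain ⟨U, e, hUU, hUU', hcfc⟩ := exists_cfc_eq_mul_diagonal_mul hM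
  set D : Matrix n n ℂ := Matrix.diagonal (fun i => (r (e.symm i) : ℂ)) with hD
  have hD0 : D.PosSemidef := Matrix.PosSemidef.diagonal fun i => by simpa using hr0 _
  have hD1 : (1 - D).PosSemidef := by
    have : 1 - D = Matrix.diagonal (fun i => ((1 - r (e.symm i) : ℝ) : ℂ)) := by
      rw [hD, ← Matrix.diagonal_one, Matrix.diagonal_sub]
      simp
    rw [this]
    exact Matrix.PosSemidef.diagonal fun i => by
      simpa using Complex.zero_le_real.2 (sub_nonneg.2 (hr1 (e.symm i)))
  refine ⟨U * D * U.conjTranspose, hD0.mul_mul_conjTranspose_same U, ?_, ?_, ?_⟩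
  · have := hD1.mul_mul_conjTranspose_same U
    rwa [mul_sub, sub_mul, mul_one, hUU'] at this
  · rw [Matrix.trace_mul_comm, ← mul_assoc, hUU, one_mul, hD, Matrix.trace_diagonal,
      Complex.re_sum, ← e.sum_comp]
    simp
  · intro h
    have h2 : U * D * U.conjTranspose * (U * Matrix.diagonal (fun i => (h (eigDown M (e.symm i)) : ℂ)) *
        U.conjTranspose) = U * (D * Matrix.diagonal (fun i => (h (eigDown M (e.symm i)) : ℂ))) *
        U.conjTranspose := by
      calc _ = U * D * (U.conjTranspose * U) *
            Matrix.diagonal (fun i => (h (eigDown M (e.symm i)) : ℂ)) * U.conjTranspose := by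
              simp only [mul_assoc]
        _ = _ := by rw [hUU, mul_one]; simp only [mul_assoc]
    rw [hcfc, h2, Matrix.trace_mul_comm, ← mul_assoc, hUU, one_mul, hD, Matrix.diagonal_mul_diagonal,
      Matrix.trace_diagonal, Complex.re_sum, ← e.sum_comp]
    refine Finset.sum_congr rfl fun j _ => ?_
    simp

theorem rank_cfc {M : Matrix n n ℂ} (hM : M.IsHermitian) (h : ℝ → ℝ) :
    (cfc h M).rank = (Finset.univ.filter fun j => h (eigDown M j) ≠ 0).card := by
  obtain ⟨U, e, hUU, hUU', hcfc⟩ := exists_cfc_eq_mul_diagonal_mul hM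
  have hU : IsUnit U.det := (Matrix.isUnit_iff_isUnit_det U).1 ⟨⟨U, _, hUU', hUU⟩, rfl⟩
  have hU' : IsUnit U.conjTranspose.det :=
    (Matrix.isUnit_iff_isUnit_det _).1 ⟨⟨_, U, hUU, hUU'⟩, rfl⟩
  rw [hcfc, Matrix.rank_mul_eq_left_of_isUnit_det _ _ hU',
    Matrix.rank_mul_eq_right_of_isUnit_det _ _ hU, Matrix.rank_diagonal, Fintype.card_subtype]
  refine Finset.card_equiv e.symm fun i => ?_
  simp

theorem trace_re_cfc {M : Matrix n n ℂ} (hM : M.IsHermitian) (h : ℝ → ℝ) :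
    (cfc h M).trace.re = ∑ j, h (eigDown M j) := by
  obtain ⟨U, e, hUU, hUU', hcfc⟩ := exists_cfc_eq_mul_diagonal_mul hM
  rw [hcfc, Matrix.trace_mul_comm, ← mul_assoc, hUU, one_mul, Matrix.trace_diagonal,
    Complex.re_sum, ← e.sum_comp]
  simp

end Spectral

theorem Matrix.rank_add_le_rank_add_rank {n : Type*} [Fintype n] (M N : Matrix n n ℂ) :
    (M + N).rank ≤ M.rank + N.rank := by
  unfold Matrix.rank
  rw [Matrix.mulVecLin_add]
  exact (Submodule.finrank_mono (LinearMap.range_add_le _ _)).trans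
    (Submodule.finrank_add_le_finrank_add_finrank _ _)

theorem Matrix.IsHermitian.add_real_smul {n : Type*} {G C : Matrix n n ℂ} (hG : G.IsHermitian)
    (hC : C.IsHermitian) (t : ℝ) : (G + t • C).IsHermitian :=
  hG.add (by simp [Matrix.IsHermitian, Matrix.conjTranspose_smul, hC.eq])

/-! ### Trace inequalities for positive semidefinite matrices. -/

section

variable {n : Type*} [Fintype n] [DecidableEq n]

theorem Matrix.PosSemidef.eigDown_nonneg {M : Matrix n n ℂ} (hM : M.PosSemidef)
    (j : Fin (Fintype.card n)) : 0 ≤ eigDown M j := by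
  rw [eigDown_of_isHermitian hM.isHermitian]
  simpa [Matrix.IsHermitian.eigenvalues] using
    hM.eigenvalues_nonneg (Fintype.equivOfCardEq (Fintype.card_fin (Fintype.card n)) j)

theorem trace_re_mul_nonneg {R X : Matrix n n ℂ} (hR : R.PosSemidef) (hX : X.PosSemidef) :
    0 ≤ (R * X).trace.re := by
  obtain ⟨w, hw0, -, -, hw⟩ := exists_spectral_weights hX.isHermitian hR
  have := hw fun x => x
  rw [hX.isHermitian.cfc_id_eq] at this
  rw [this]
  exact Finset.sum_nonneg fun j _ => mul_nonneg (hw0 j) (hX.eigDown_nonneg j)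

theorem posSemidef_cfc {M : Matrix n n ℂ} (hM : M.IsHermitian) {h : ℝ → ℝ}
    (hh : ∀ j, 0 ≤ h (eigDown M j)) : (cfc h M).PosSemidef := by
  obtain ⟨U, e, -, -, hcfc⟩ := exists_cfc_eq_mul_diagonal_mul hM
  rw [hcfc]
  exact (Matrix.PosSemidef.diagonal fun i => by simpa using hh _).mul_mul_conjTranspose_same U

theorem isHermitian_cfc (M : Matrix n n ℂ) (h : ℝ → ℝ) : (cfc h M).IsHermitian :=
  cfc_predicate h M

theorem sub_cfc_eq_cfc {M : Matrix n n ℂ} (hM : M.IsHermitian) (h : ℝ → ℝ) :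
    M - cfc h M = cfc (fun x => x - h x) M := by
  obtain ⟨U, e, -, -, hcfc⟩ := exists_cfc_eq_mul_diagonal_mul hM
  nth_rewrite 1 [← hM.cfc_id_eq]
  rw [hcfc, hcfc, hcfc, ← sub_mul, ← mul_sub, Matrix.diagonal_sub]
  simp

/-- The trace inequality `tr (A - c)₊ + tr (B - c)₊ ≤ tr (A + B - c)₊` for positive
semidefinite `A` and `B`. -/
theorem sum_max_sub_add_sum_max_sub_le {A B : Matrix n n ℂ} (hA : A.PosSemidef)
    (hB : B.PosSemidef) {c : ℝ} (hc : 0 ≤ c) :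
    ∑ j, max (eigDown A j - c) 0 + ∑ j, max (eigDown B j - c) 0
      ≤ ∑ j, max (eigDown (A + B) j - c) 0 := by
  -- Keeping only eigenvalues above c gives tr (M - c)₊ = tr h(M) - c · rank h(M), and rank is
  -- subadditive.
  set h : ℝ → ℝ := fun x => if c < x then x else 0 with hh
  have hh0 : ∀ {M : Matrix n n ℂ}, M.PosSemidef → (cfc h M).PosSemidef := fun hM =>
    posSemidef_cfc hM.isHermitian fun j => by
      simp only [hh]
      split_ifs
      exacts [hM.eigDown_nonneg j, le_rfl]
  have hsub : ∀ {M : Matrix n n ℂ}, M.PosSemidef → (M - cfc h M).PosSemidef := fun {M} hM => by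
    rw [sub_cfc_eq_cfc hM.isHermitian]
    refine posSemidef_cfc hM.isHermitian fun j => ?_
    have := hM.eigDown_nonneg j
    simp only [hh]
    split_ifs <;> simp [this]
  have hsum : ∀ {M : Matrix n n ℂ}, M.PosSemidef →
      ∑ j, max (eigDown M j - c) 0 = (cfc h M).trace.re - c * (cfc h M).rank := by
    intro M hM
    rw [trace_re_cfc hM.isHermitian, rank_cfc hM.isHermitian, ← Finset.sum_boole, Finset.mul_sum,
      ← Finset.sum_sub_distrib]
    refine Finset.sum_congr rfl fun j _ => ?_
    simp only [hh]
    by_cases hj : c < eigDown M j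
    · simp [hj, (hc.trans_lt hj).ne', hj.le]
    · simp [hj, not_lt.1 hj]
  set H := cfc h A + cfc h B with hH
  have hHps : H.PosSemidef := (hh0 hA).add (hh0 hB)
  have hGH : (A + B - H).PosSemidef := by
    have := (hsub hA).add (hsub hB)
    rwa [sub_add_sub_comm] at this
  -- T is the projection onto the range of H, so tr T = rank H and tr(TH) = tr H, while H ≤ A + B.
  obtain ⟨T, hT0, hT1, hTtr, hT⟩ := exists_posSemidef_of_spectral_weights hHps.isHermitian
    (r := fun j => if eigDown H j ≠ 0 then 1 else 0)
    (fun j => by split_ifs <;> norm_num) (fun j => by split_ifs <;> norm_num)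
  have hTrank : T.trace.re = H.rank := by
    have h1 := rank_cfc hHps.isHermitian fun x => x
    rw [hHps.isHermitian.cfc_id_eq] at h1
    rw [hTtr, h1, Finset.sum_boole]
  have hTH : (T * H).trace.re = H.trace.re := by
    have h1 := hT fun x => x
    have h2 := trace_re_cfc hHps.isHermitian fun x => x
    rw [hHps.isHermitian.cfc_id_eq] at h1 h2
    rw [h1, h2]
    refine Finset.sum_congr rfl fun j _ => ?_
    split_ifs with hj
    · rw [one_mul]
    · rw [zero_mul, not_not.1 hj]
  have hTG : (T * H).trace.re ≤ (T * (A + B)).trace.re := by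
    have := trace_re_mul_nonneg hT0 hGH
    rw [mul_sub, Matrix.trace_sub, Complex.sub_re] at this
    linarith
  have hG : (A + B).IsHermitian := (hA.add hB).isHermitian
  obtain ⟨w, hw0, hw1, hwtr, hw⟩ := exists_spectral_weights hG hT0
  have hwG := hw fun x => x
  rw [hG.cfc_id_eq] at hwG
  have hle : ∑ j, w j * (eigDown (A + B) j - c) ≤ ∑ j, max (eigDown (A + B) j - c) 0 :=
    Finset.sum_le_sum fun j _ =>
      (mul_le_mul_of_nonneg_left (le_max_left _ 0) (hw0 j)).trans
        (mul_le_of_le_one_left (le_max_right _ _) (hw1 hT1 j))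
  simp_rw [mul_sub] at hle
  rw [Finset.sum_sub_distrib, ← Finset.sum_mul, ← hwG, hwtr, hTrank] at hle
  have hrank : c * (H.rank : ℝ) ≤ c * ((cfc h A).rank + (cfc h B).rank) := by
    refine mul_le_mul_of_nonneg_left ?_ hc
    exact_mod_cast Matrix.rank_add_le_rank_add_rank _ _
  rw [hsum hA, hsum hB]
  have htr : H.trace.re = (cfc h A).trace.re + (cfc h B).trace.re := by
    rw [hH, Matrix.trace_add, Complex.add_re]
  linarith

/-- The sum of the `k` largest eigenvalues dominates `tr (R M)` for every `0 ≤ R ≤ 1` of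
trace `k`. -/
theorem trace_re_mul_le_headSum_eigDown {M R : Matrix n n ℂ} (hM : M.IsHermitian)
    (hR0 : R.PosSemidef) (hR1 : (1 - R).PosSemidef) {k : ℕ} (hk : k ≤ Fintype.card n)
    (hR : R.trace.re = k) : (R * M).trace.re ≤ headSum k (eigDown M) := by
  obtain ⟨w, hw0, hw1, hwtr, hw⟩ := exists_spectral_weights hM hR0
  have := hw fun x => x
  rw [hM.cfc_id_eq] at this
  rw [this]
  exact sum_mul_le_headSum hk (eigDown_antitone M) hw0 (hw1 hR1) (hwtr.trans hR)

/-- R projects onto k leading eigenvectors of M; the formula for h needs no monotonicity. -/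
theorem exists_trace_re_mul_cfc_eq_headSum {M : Matrix n n ℂ} (hM : M.IsHermitian) {k : ℕ}
    (hk : k ≤ Fintype.card n) : ∃ R : Matrix n n ℂ, R.PosSemidef ∧ (1 - R).PosSemidef ∧
      R.trace.re = k ∧ (R * M).trace.re = headSum k (eigDown M) ∧
      ∀ h : ℝ → ℝ, (R * cfc h M).trace.re = headSum k fun j => h (eigDown M j) := by
  obtain ⟨R, hR0, hR1, hRtr, hR⟩ := exists_posSemidef_of_spectral_weights hM
    (r := fun j => if j.val < k then 1 else 0)
    (fun j => by split_ifs <;> norm_num) (fun j => by split_ifs <;> norm_num)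
  have h1 : ∀ h : ℝ → ℝ, (R * cfc h M).trace.re = headSum k fun j => h (eigDown M j) := fun h => by
    rw [hR, headSum_eq_sum_ite]
  refine ⟨R, hR0, hR1, ?_, ?_, h1⟩
  · rw [hRtr, Finset.sum_boole, card_filter_val_lt hk]
  · simpa only [hM.cfc_id_eq] using h1 fun x => x

theorem sum_mul_max_sub_le_headSum {A B R : Matrix n n ℂ} (hA : A.PosSemidef) (hB : B.PosSemidef)
    (hR0 : R.PosSemidef) (hR1 : (1 - R).PosSemidef) {k : ℕ} (hk : k ≤ Fintype.card n)
    (hR : R.trace.re = k) {u v : Fin (Fintype.card n) → ℝ}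
    (hu0 : ∀ j, 0 ≤ u j) (hu1 : ∀ j, u j ≤ 1) (hv0 : ∀ j, 0 ≤ v j) (hv1 : ∀ j, v j ≤ 1)
    (hu : ∑ j, u j = k) (hv : ∑ j, v j = k)
    (huA : (R * A).trace.re = ∑ j, u j * eigDown A j)
    (hvB : (R * B).trace.re = ∑ j, v j * eigDown B j) {c : ℝ} (hc : 0 ≤ c) :
    ∑ j, u j * max (eigDown A j - c) 0 + ∑ j, v j * max (eigDown B j - c) 0
      ≤ headSum k fun j => max (eigDown (A + B) j - c) 0 := by
  have hle : ∀ (c : ℝ) (a w : Fin (Fintype.card n) → ℝ), (∀ j, 0 ≤ w j) → (∀ j, w j ≤ 1) →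
      ∑ j, w j * max (a j - c) 0 ≤ ∑ j, max (a j - c) 0 := fun c a w _ h =>
    Finset.sum_le_sum fun j _ => mul_le_of_le_one_left (le_max_right _ _) (h j)
  rcases Nat.eq_zero_or_pos k with rfl | hk0
  · have hz : ∀ w : Fin (Fintype.card n) → ℝ, (∀ j, 0 ≤ w j) → ∑ j, w j = (0 : ℕ) →
        ∀ j, w j = 0 := fun w hw h => by
      simpa [Finset.sum_eq_zero_iff_of_nonneg (fun j _ => hw j)] using h
    simp [hz u hu0 hu, hz v hv0 hv, headSum]
  have hanti := eigDown_antitone (A + B)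
  set s := eigDown (A + B) ⟨k - 1, by omega⟩ with hs
  have hlt : ∀ j : Fin (Fintype.card n), j.val < k → s ≤ eigDown (A + B) j := fun j hj =>
    hanti (Fin.mk_le_mk.2 (by omega) : j ≤ ⟨k - 1, by omega⟩)
  have hge : ∀ j : Fin (Fintype.card n), ¬ j.val < k → eigDown (A + B) j ≤ s := fun j hj =>
    hanti (Fin.mk_le_mk.2 (by omega) : (⟨k - 1, by omega⟩ : Fin _) ≤ j)
  have key : ∀ c, 0 ≤ c → s ≤ c →
      ∑ j, u j * max (eigDown A j - c) 0 + ∑ j, v j * max (eigDown B j - c) 0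
        ≤ headSum k fun j => max (eigDown (A + B) j - c) 0 := by
    intro c hc hsc
    -- For c ≥ s the hinge vanishes on all eigenvalues after the k-th.
    have h1 : ∑ j, max (eigDown (A + B) j - c) 0
        = headSum k fun j => max (eigDown (A + B) j - c) 0 := by
      rw [headSum_eq_sum_ite]
      refine Finset.sum_congr rfl fun j _ => ?_
      split_ifs with hj
      · rw [one_mul]
      · rw [zero_mul, max_eq_right (sub_nonpos.2 ((hge j hj).trans hsc))]
    rw [← h1]
    exact (add_le_add (hle c _ u hu0 hu1) (hle c _ v hv0 hv1)).trans
      (sum_max_sub_add_sum_max_sub_le hA hB hc)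
  rcases le_or_gt s c with hsc | hcs
  · exact key c hc hsc
  have hs0 : 0 < s := hc.trans_lt hcs
  have hp0 : 0 ≤ c / s := by positivity
  have hp1 : c / s ≤ 1 := (div_le_one hs0).2 hcs.le
  -- The hinge is convex in c, and c = (c/s)·s + (1 - c/s)·0. On the right side of the goal, the
  -- head sum is affine in c for c ≤ s, so nothing is lost there.
  have hpt : ∀ x, 0 ≤ x → max (x - c) 0 ≤ c / s * max (x - s) 0 + (1 - c / s) * x := by
    intro x hx
    have h1 : c / s * s = c := div_mul_cancel₀ _ hs0.ne'
    refine max_le ?_ ?_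
    · have := mul_le_mul_of_nonneg_left (le_max_left (x - s) 0) hp0
      nlinarith
    · have := le_max_right (x - s) 0
      have := sub_nonneg.2 hp1
      positivity
  have hsum : ∀ {M : Matrix n n ℂ} (w : Fin (Fintype.card n) → ℝ), M.PosSemidef →
      (∀ j, 0 ≤ w j) → ∑ j, w j * max (eigDown M j - c) 0 ≤
        c / s * ∑ j, w j * max (eigDown M j - s) 0 + (1 - c / s) * ∑ j, w j * eigDown M j := by
    intro M w hM hw
    rw [Finset.mul_sum, Finset.mul_sum, ← Finset.sum_add_distrib]
    refine Finset.sum_le_sum fun j _ => ?_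
    have := mul_le_mul_of_nonneg_left (hpt _ (hM.eigDown_nonneg j)) (hw j)
    linarith
  have hRG := trace_re_mul_le_headSum_eigDown (hA.add hB).isHermitian hR0 hR1 hk hR
  rw [mul_add, Matrix.trace_add, Complex.add_re, huA, hvB] at hRG
  have hmax : ∀ d, d ≤ s → (headSum k fun j => max (eigDown (A + B) j - d) 0)
      = headSum k (eigDown (A + B)) - k * d := by
    intro d hd
    rw [← headSum_const hk, headSum, headSum, headSum, ← Finset.sum_sub_distrib]
    refine Finset.sum_congr rfl fun j hj => ?_
    rw [max_eq_left (sub_nonneg.2 (hd.trans (hlt j (by simpa using hj))))]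
  have h1 := mul_le_mul_of_nonneg_left (key s hs0.le le_rfl) hp0
  have h2 := mul_le_mul_of_nonneg_left hRG (sub_nonneg.2 hp1)
  have h3 := hsum u hA hu0
  have h4 := hsum v hB hv0
  rw [hmax s le_rfl] at h1
  rw [hmax c hcs.le]
  have h5 : c / s * (k * s) = k * c := by field_simp
  nlinarith

/-- For convex `g` with `g 0 = 0`, non-negative on the spectra, and every `0 ≤ R ≤ 1` of trace `k`,
`tr (R (g(A) + g(B)))` is at most the sum of `g` over the `k` largest eigenvalues of `A + B`. -/
theorem trace_re_mul_cfc_add_cfc_le {A B R : Matrix n n ℂ} (hA : A.PosSemidef)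
    (hB : B.PosSemidef) (hR0 : R.PosSemidef) (hR1 : (1 - R).PosSemidef) {k : ℕ}
    (hk : k ≤ Fintype.card n) (hR : R.trace.re = k) {g : ℝ → ℝ}
    (hg : ConvexOn ℝ (Set.Ici 0) g) (hg0 : g 0 = 0) (hgA : ∀ j, 0 ≤ g (eigDown A j))
    (hgB : ∀ j, 0 ≤ g (eigDown B j)) (hgAB : ∀ j, 0 ≤ g (eigDown (A + B) j)) :
    (R * (cfc g A + cfc g B)).trace.re ≤ headSum k fun j => g (eigDown (A + B) j) := by
  obtain ⟨u, hu0, hu1, hutr, hu⟩ := exists_spectral_weights hA.isHermitian hR0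
  obtain ⟨v, hv0, hv1, hvtr, hv⟩ := exists_spectral_weights hB.isHermitian hR0
  have huA := hu fun x => x
  have hvB := hv fun x => x
  rw [hA.isHermitian.cfc_id_eq] at huA
  rw [hB.isHermitian.cfc_id_eq] at hvB
  rw [mul_add, Matrix.trace_add, Complex.add_re, hu, hv]
  obtain ⟨F, hF, hFg⟩ := exists_sum_max_eqOn_finset
    (fun F => ∑ j, u j * F (eigDown A j) + ∑ j, v j * F (eigDown B j)
      ≤ headSum k fun j => F (eigDown (A + B) j)) (by simp [headSum]) (fun F c s hF hc hs => by
        have h1 := mul_le_mul_of_nonneg_left (sum_mul_max_sub_le_headSum hA hB hR0 hR1 hk hR hu0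
          (hu1 hR1) hv0 (hv1 hR1) (hutr.trans hR) (hvtr.trans hR) huA hvB hc) hs
        rw [headSum_add, headSum_const_mul]
        simp_rw [mul_add, mul_left_comm _ s, Finset.sum_add_distrib, ← Finset.mul_sum]
        linarith) hg hg0
    (Finset.univ.image (eigDown A) ∪ Finset.univ.image (eigDown B) ∪
      Finset.univ.image (eigDown (A + B))) (by
        intro x hx
        simp only [Finset.mem_union, Finset.mem_image, Finset.mem_univ, true_and] at hx
        rcases hx with (⟨j, rfl⟩ | ⟨j, rfl⟩) | ⟨j, rfl⟩
        exacts [⟨hA.eigDown_nonneg j, hgA j⟩, ⟨hB.eigDown_nonneg j, hgB j⟩,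
          ⟨(hA.add hB).eigDown_nonneg j, hgAB j⟩])
  have hFA : ∀ j, F (eigDown A j) = g (eigDown A j) := fun j => hFg _ (by simp)
  have hFB : ∀ j, F (eigDown B j) = g (eigDown B j) := fun j => hFg _ (by simp)
  have hFAB : ∀ j, F (eigDown (A + B) j) = g (eigDown (A + B) j) := fun j => hFg _ (by simp)
  simpa only [hFA, hFB, hFAB] using hF

/-- For concave `f` with `f 0 ≥ 0` and every `0 ≤ R ≤ 1` of trace `k` on which `tr (R (A + B))`
is maximal, `tr (R (f(A) + f(B)))` is at least the sum of `f` over the `k` largest eigenvalues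
of `A + B`. -/
theorem le_trace_re_mul_cfc_add_cfc {A B R : Matrix n n ℂ} (hA : A.PosSemidef)
    (hB : B.PosSemidef) (hR0 : R.PosSemidef) (hR1 : (1 - R).PosSemidef) {k : ℕ}
    (hk : k ≤ Fintype.card n) (hR : R.trace.re = k)
    (hRG : (R * (A + B)).trace.re = headSum k (eigDown (A + B))) {f : ℝ → ℝ}
    (hf : ConcaveOn ℝ (Set.Ici 0) f) (hf0 : 0 ≤ f 0) :
    (headSum k fun j => f (eigDown (A + B) j)) ≤ (R * (cfc f A + cfc f B)).trace.re := by
  set S : Finset ℝ := Finset.univ.image (eigDown A) ∪ Finset.univ.image (eigDown B) ∪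
    Finset.univ.image (eigDown (A + B)) with hS
  -- c bounds every chord slope of f from 0 to a spectral point, so cx - f(x) + f(0) is non-negative
  -- on the spectra.
  obtain ⟨c, hc⟩ := (S.image fun x => (f x - f 0) / x).exists_le
  have hgS : ∀ x ∈ S, 0 ≤ x → 0 ≤ c * x - f x + f 0 := by
    intro x hx hx0
    rcases hx0.eq_or_lt with rfl | hx0
    · simp
    · have := (div_le_iff₀ hx0).1 (hc _ (Finset.mem_image_of_mem _ hx))
      linarith
  have hg : ConvexOn ℝ (Set.Ici 0) fun x => c * x - f x + f 0 := by
    have h1 : ConvexOn ℝ (Set.Ici (0 : ℝ)) fun x => c * x :=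
      (LinearMap.mulLeft ℝ c).convexOn (convex_Ici 0)
    exact (h1.sub hf).add_const _
  have key := trace_re_mul_cfc_add_cfc_le hA hB hR0 hR1 hk hR hg (by simp)
    (fun j => hgS _ (by simp [hS]) (hA.eigDown_nonneg j))
    (fun j => hgS _ (by simp [hS]) (hB.eigDown_nonneg j))
    (fun j => hgS _ (by simp [hS]) ((hA.add hB).eigDown_nonneg j))
  have hcfc : ∀ {M : Matrix n n ℂ}, M.PosSemidef →
      (R * cfc (fun x => c * x - f x + f 0) M).trace.re
        = c * (R * M).trace.re - (R * cfc f M).trace.re + k * f 0 := by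
    intro M hM
    obtain ⟨w, -, -, hwtr, hw⟩ := exists_spectral_weights hM.isHermitian hR0
    have hwM := hw fun x => x
    rw [hM.isHermitian.cfc_id_eq] at hwM
    rw [hw, hwM, hw, ← hR, ← hwtr, Finset.mul_sum, Finset.sum_mul, ← Finset.sum_sub_distrib,
      ← Finset.sum_add_distrib]
    exact Finset.sum_congr rfl fun j _ => by ring
  have hhead : (headSum k fun j => c * eigDown (A + B) j - f (eigDown (A + B) j) + f 0)
      = c * headSum k (eigDown (A + B)) - (headSum k fun j => f (eigDown (A + B) j)) + k * f 0 := by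
    rw [headSum_add, headSum_const hk]
    simp [headSum, Finset.mul_sum]
  rw [mul_add, Matrix.trace_add, Complex.add_re, hcfc hA, hcfc hB, hhead, ← hRG, mul_add,
    Matrix.trace_add, Complex.add_re] at key
  rw [mul_add, Matrix.trace_add, Complex.add_re]
  have : 0 ≤ (k : ℝ) * f 0 := by positivity
  linarith

/-! ### One-sided derivatives -/

theorem trace_re_mul_add_smul (R G C : Matrix n n ℂ) (t : ℝ) :
    (R * (G + t • C)).trace.re = (R * G).trace.re + t * (R * C).trace.re := by
  simp [mul_add, Matrix.trace_add]

theorem deltaExists_of_isHermitian {G C : Matrix n n ℂ} (hG : G.IsHermitian)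
    (hC : C.IsHermitian) : DeltaExists C G := by
  intro k hk
  -- A maximum of the affine functions t ↦ tr(R(G + tC)) is convex, hence has a right derivative.
  have hconv : ConvexOn ℝ Set.univ fun t : ℝ => headSum k (eigDown (G + t • C)) := by
    refine ⟨convex_univ, fun x _ y _ a b ha hb hab => ?_⟩
    obtain ⟨R, hR0, hR1, hR, hRM, -⟩ :=
      exists_trace_re_mul_cfc_eq_headSum (hG.add_real_smul hC (a • x + b • y)) hk
    have hx := trace_re_mul_le_headSum_eigDown (hG.add_real_smul hC x) hR0 hR1 hk hR
    have hy := trace_re_mul_le_headSum_eigDown (hG.add_real_smul hC y) hR0 hR1 hk hR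
    rw [trace_re_mul_add_smul] at hx hy hRM
    simp only [smul_eq_mul] at hRM ⊢
    rw [← hRM]
    have h1 := mul_le_mul_of_nonneg_left hx ha
    have h2 := mul_le_mul_of_nonneg_left hy hb
    have h3 : (R * G).trace.re = a * (R * G).trace.re + b * (R * G).trace.re := by
      rw [← add_mul, hab, one_mul]
    linarith
  have hd := (hconv.differentiableWithinAt_Ioi_of_mem_interior (x := 0) (by simp)).hasDerivWithinAt
  have := (hasDerivWithinAt_Ioi_iff_Ici.1 hd).differentiableWithinAt.hasDerivWithinAt
  rwa [headSum_delta C G k hk]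

theorem weakMajDW_delta_of_headSum_le {G C D : Matrix n n ℂ} (hC : DeltaExists C G)
    (hD : DeltaExists D G) (h : ∀ k ≤ Fintype.card n, ∀ t : ℝ, 0 ≤ t →
      headSum k (eigDown (G + t • C)) ≤ headSum k (eigDown (G + t • D))) :
    WeakMajDW (delta C G) (delta D G) := by
  intro k hk
  have h1 := hasDerivWithinAt_iff_tendsto_slope.1 (hC k hk)
  have h2 := hasDerivWithinAt_iff_tendsto_slope.1 (hD k hk)
  have : (Set.Ici (0 : ℝ) \ {0}) = Set.Ioi 0 := Set.Ici_sdiff_left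
  rw [this] at h1 h2
  refine le_of_tendsto_of_tendsto h1 h2 (Filter.eventually_of_mem self_mem_nhdsWithin ?_)
  intro t ht
  have ht0 : (0 : ℝ) < t := ht
  simp only [slope_def_field, sub_zero, zero_smul, add_zero]
  exact div_le_div_of_nonneg_right (sub_le_sub_right (h k hk t ht0.le) _) ht0.le

end

/-! ### Comparison of the perturbed head sums. -/

theorem mainTheorem8 {n : Type*} [Fintype n] [DecidableEq n] (A B : Matrix n n ℂ)
    (hA : A.PosSemidef) (hB : B.PosSemidef) :
    (∀ f : ℝ → ℝ, ConcaveOn ℝ (Set.Ici 0) f → (∀ x : ℝ, 0 ≤ x → 0 ≤ f x) →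
      DeltaExists (cfc f (A + B)) (A + B) ∧
      DeltaExists (cfc f A + cfc f B) (A + B) ∧
      WeakMajDW (delta (cfc f (A + B)) (A + B)) (delta (cfc f A + cfc f B) (A + B))) ∧
    (∀ g : ℝ → ℝ, ConvexOn ℝ (Set.Ici 0) g → (∀ x : ℝ, 0 ≤ x → 0 ≤ g x) → g 0 = 0 →
      DeltaExists (cfc g (A + B)) (A + B) ∧
      DeltaExists (cfc g A + cfc g B) (A + B) ∧
      WeakMajDW (delta (cfc g A + cfc g B) (A + B)) (delta (cfc g (A + B)) (A + B))) := by
  have hG : (A + B).IsHermitian := (hA.add hB).isHermitian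
  have hex : ∀ f : ℝ → ℝ, DeltaExists (cfc f (A + B)) (A + B) := fun f =>
    deltaExists_of_isHermitian hG (isHermitian_cfc _ f)
  have hex' : ∀ f : ℝ → ℝ, DeltaExists (cfc f A + cfc f B) (A + B) := fun f =>
    deltaExists_of_isHermitian hG ((isHermitian_cfc _ f).add (isHermitian_cfc _ f))
  have hsum : ∀ f : ℝ → ℝ, (cfc f A + cfc f B).IsHermitian := fun f =>
    (isHermitian_cfc _ f).add (isHermitian_cfc _ f)
  refine ⟨fun f hf hf0 => ⟨hex f, hex' f, ?_⟩, fun g hg hg0 hg00 => ⟨hex g, hex' g, ?_⟩⟩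
  · refine weakMajDW_delta_of_headSum_le (hex f) (hex' f) fun k hk t ht => ?_
    have hmono := monotoneOn_of_concaveOn_of_nonneg hf hf0
    -- Since f is monotone, the values f(λ_j) at the k largest λ_j are also the k largest values.
    have hle : headSum k (eigDown (A + B + t • cfc f (A + B)))
        ≤ headSum k (eigDown (A + B)) + t * headSum k fun j => f (eigDown (A + B) j) := by
      obtain ⟨R, hR0, hR1, hR, hRM, -⟩ :=
        exists_trace_re_mul_cfc_eq_headSum (hG.add_real_smul (isHermitian_cfc (A + B) f) t) hk
      obtain ⟨w, hw0, hw1, hwtr, hw⟩ := exists_spectral_weights hG hR0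
      rw [← hRM, trace_re_mul_add_smul, hw]
      refine add_le_add (trace_re_mul_le_headSum_eigDown hG hR0 hR1 hk hR)
        (mul_le_mul_of_nonneg_left ?_ ht)
      exact sum_mul_le_headSum (a := fun j => f (eigDown (A + B) j)) hk
        (fun i j hij => hmono ((hA.add hB).eigDown_nonneg j)
          ((hA.add hB).eigDown_nonneg i) (eigDown_antitone _ hij)) hw0 (hw1 hR1) (hwtr.trans hR)
    obtain ⟨R, hR0, hR1, hR, hRM, -⟩ := exists_trace_re_mul_cfc_eq_headSum hG hk
    have h1 := trace_re_mul_le_headSum_eigDown (hG.add_real_smul (hsum f) t) hR0 hR1 hk hR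
    rw [trace_re_mul_add_smul, hRM] at h1
    have h2 := mul_le_mul_of_nonneg_left
      (le_trace_re_mul_cfc_add_cfc hA hB hR0 hR1 hk hR hRM hf (hf0 0 le_rfl)) ht
    linarith
  · refine weakMajDW_delta_of_headSum_le (hex' g) (hex g) fun k hk t ht => ?_
    obtain ⟨R, hR0, hR1, hR, hRM, hRg⟩ := exists_trace_re_mul_cfc_eq_headSum hG hk
    have h1 := trace_re_mul_le_headSum_eigDown
      (hG.add_real_smul (isHermitian_cfc (A + B) g) t) hR0 hR1 hk hR
    rw [trace_re_mul_add_smul, hRM, hRg] at h1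
    obtain ⟨Q, hQ0, hQ1, hQ, hQM, -⟩ :=
      exists_trace_re_mul_cfc_eq_headSum (hG.add_real_smul (hsum g) t) hk
    rw [← hQM, trace_re_mul_add_smul]
    have h2 := trace_re_mul_le_headSum_eigDown hG hQ0 hQ1 hk hQ
    have h3 := mul_le_mul_of_nonneg_left (trace_re_mul_cfc_add_cfc_le hA hB hQ0 hQ1 hk hQ hg hg00
      (fun j => hg0 _ (hA.eigDown_nonneg j)) (fun j => hg0 _ (hB.eigDown_nonneg j))
      (fun j => hg0 _ ((hA.add hB).eigDown_nonneg j))) ht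
    linarith
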